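/- Let $p,q$ be natural numbers with $pq\ge 6$ and let $\Delta^+=\mathbb{Z}_p*\mathbb{Z}_q$ be the free product of the cyclic groups of orders $p$ and $q$. A hypermap on $n$ darts is a pair of permutations $\alpha,\sigma$ of the nonempty set $D=\{1,\dots,n\}$ generating a group that acts transitively on $D$. Put $\varphi=\sigma^{-1}\alpha^{-1}$ (permutations multiplied from left to right). The hypermap is a $(p,q)$-hypermap if every cycle of $\alpha$ has length $p$ and every cycle of $\varphi$ has length $q$. Hypermaps $(\alpha_1,\sigma_1)$ and $(\alpha_2,\sigma_2)$ on $n$ darts are isomorphic if there is a permutation $\psi$ of $D$ with $\psi\alpha_1\psi^{-1}=\alpha_2$ and $\psi\sigma_1\psi^{-1}=\sigma_2$. Let $\mathfrak{H}_{p,q}(n)$ be the set of isomorphism classes of $(p,q)$-hypermaps on $n$ darts (so $\mathfrak{H}_{p,q}(0)=\emptyset$), and let $$\widetilde H(z)=\sum_{n=0}^{\infty}|\mathfrak{H}_{p,q}(n)|\,z^n .$$ Then for each $n$ the number $c_f(n)$ of conjugacy classes of free subgroups of (finite) index $n$ in $\Delta^+$ is finite, and the conjugacy growth series $$C_f(z)=\sum_{n=0}^{\infty}c_f(n)\,z^n$$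 coincides with $\widetilde H(z)$. -/

import Mathlib

/-- An oriented labelled combinatorial hypermap with set of darts `D`: two permutations
`α`, `σ` of the (nonempty) set `D` such that the group generated by them acts transitively. -/
structure Hypermap (D : Type*) where
  α : Equiv.Perm D
  σ : Equiv.Perm D
  nonempty : Nonempty D
  transitive : MulAction.IsPretransitive (Subgroup.closure {α, σ}) D

namespace Hypermap

/-- The permutation `φ = σ⁻¹ α⁻¹`, permutations being multiplied from left to right there
(first `σ⁻¹`, then `α⁻¹`); the product of `Equiv.Perm` is composition of functions, so the
factors appear in the other order. Its cycles are the hyper-faces. -/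
def φ {D : Type*} (H : Hypermap D) : Equiv.Perm D := H.α⁻¹ * H.σ⁻¹

/-- All cycles of `f` have length `m` (a fixed point is a cycle of length `1`): the cycle
through `x` has length `Function.minimalPeriod f x`. -/
def AllCyclesHaveLength {D : Type*} (f : Equiv.Perm D) (m : ℕ) : Prop :=
  ∀ x : D, Function.minimalPeriod f x = m

/-- A `(p,q)`-hypermap: all hyper-edges are `p`-gons and all hyper-faces are `q`-gons. -/
def IsPQ {D : Type*} (p q : ℕ) (H : Hypermap D) : Prop :=
  AllCyclesHaveLength H.α p ∧ AllCyclesHaveLength H.φ q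

/-- Isomorphism of (unlabelled, unrooted) hypermaps on the same set of darts. -/
def Isomorphic {D : Type*} (H₁ H₂ : Hypermap D) : Prop :=
  ∃ ψ : Equiv.Perm D, ψ * H₁.α * ψ⁻¹ = H₂.α ∧ ψ * H₁.σ * ψ⁻¹ = H₂.σ

theorem isomorphic_equivalence {D : Type*} : Equivalence (Isomorphic (D := D)) where
  refl H := ⟨1, by simp, by simp⟩
  symm := by
    rintro H₁ H₂ ⟨ψ, h₁, h₂⟩
    exact ⟨ψ⁻¹, by rw [← h₁]; group, by rw [← h₂]; group⟩
  trans := by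
    rintro H₁ H₂ H₃ ⟨ψ, h₁, h₂⟩ ⟨χ, k₁, k₂⟩
    exact ⟨χ * ψ, by rw [← k₁, ← h₁]; group, by rw [← k₂, ← h₂]; group⟩

/-- Isomorphism as an equivalence relation on the `(p,q)`-hypermaps on `n` darts. -/
def pqSetoid (p q n : ℕ) : Setoid {H : Hypermap (Fin n) // H.IsPQ p q} where
  r H₁ H₂ := Isomorphic H₁.1 H₂.1
  iseqv := isomorphic_equivalence.comap Subtype.val

/-- The set of isomorphism classes of `(p,q)`-hypermaps on `n` darts. -/
abbrev PQClasses (p q n : ℕ) : Type := Quotient (pqSetoid p q n)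

/-- The growth series `∑ₙ |PQClasses p q n| zⁿ`. -/
noncomputable def isoGrowthSeries (p q : ℕ) : PowerSeries ℤ :=
  PowerSeries.mk fun n => (Nat.card (PQClasses p q n) : ℤ)

end Hypermap

namespace FreeSubgroups

/-- The free product `ℤ_p * ℤ_q` of two cyclic groups. -/
abbrev CyclicFreeProduct (p q : ℕ) : Type :=
  Monoid.Coprod (Multiplicative (ZMod p)) (Multiplicative (ZMod q))

/-- The free subgroups of (finite) index `n` in `G`. Finiteness is required separately, since
`Subgroup.index` is `0` for subgroups of infinite index. -/
abbrev FreeOfIndex (G : Type*) [Group G] (n : ℕ) : Type _ :=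
  {Γ : Subgroup G // Γ.FiniteIndex ∧ Γ.index = n ∧ IsFreeGroup Γ}

/-- Two subgroups are conjugate. -/
def Conjugate {G : Type*} [Group G] (Γ₁ Γ₂ : Subgroup G) : Prop :=
  ∃ g : G, Γ₁.map (MulAut.conj g).toMonoidHom = Γ₂

theorem conjugate_equivalence {G : Type*} [Group G] : Equivalence (Conjugate (G := G)) where
  refl Γ := ⟨1, by ext x; simp⟩
  symm := by
    rintro Γ₁ Γ₂ ⟨g, rfl⟩
    refine ⟨g⁻¹, ?_⟩
    rw [Subgroup.map_map]
    ext x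
    simp [mul_assoc]
  trans := by
    rintro Γ₁ Γ₂ Γ₃ ⟨g, rfl⟩ ⟨h, rfl⟩
    refine ⟨h * g, ?_⟩
    rw [Subgroup.map_map]
    ext x
    simp [mul_assoc]

/-- Conjugacy as an equivalence relation on the free subgroups of index `n`. -/
def conjSetoid (G : Type*) [Group G] (n : ℕ) : Setoid (FreeOfIndex G n) where
  r Γ₁ Γ₂ := Conjugate Γ₁.1 Γ₂.1
  iseqv := conjugate_equivalence.comap Subtype.val

/-- The set of conjugacy classes of free subgroups of index `n` in `G`. -/
abbrev ConjClassesOfIndex (G : Type*) [Group G] (n : ℕ) : Type _ := Quotient (conjSetoid G n)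

/-- The conjugacy growth series `∑ₙ c_f(n) zⁿ` of `G`. -/
noncomputable def conjGrowthSeries (G : Type*) [Group G] : PowerSeries ℤ :=
  PowerSeries.mk fun n => (Nat.card (ConjClassesOfIndex G n) : ℤ)

end FreeSubgroups

/-!
A `(p,q)`-hypermap on `n` darts is the same as a transitive action of `ℤ_p * ℤ_q` on `n` points in
which both cyclic factors act freely: the generators act as `α` and `φ`, the relation
`σ = φ⁻¹ α⁻¹` (as composition of functions) recovers `σ`, and all cycles of a
permutation have length `p` exactly when it generates a free action of `ℤ_p`. Transitive actions up
to equivalence correspond to subgroups up to conjugacy by taking point stabilizers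
(`MonoidHom.conjugate_pointStabilizer_iff`, `MonoidHom.exists_pointStabilizer_eq`). It remains to
see that a point stabilizer is a free group if and only if both factors act freely
(`Monoid.Coprod.isFreeGroup_stabilizer_iff`).

If the stabilizers are free, they are torsion-free, so no nontrivial element of the finite factors
fixes a point. The converse is a special case of the Kurosh subgroup theorem. Choose a root in each
orbit of each factor; since the factors act freely, the arrows from the roots to the other points of
their orbits freely generate the action groupoid
(`Monoid.Coprod.isFreeGroupoidActionCategory`), and the stabilizers are the vertex groups of this
connected free groupoid, which are free by the argument of the Nielsen–Schreier theorem in Mathlib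
(`IsFreeGroupoid.endIsFreeOfConnectedFree`).

The finiteness follows because there are only finitely many hypermaps on `n` darts.
-/

/-! ### Action groupoids -/

namespace CategoryTheory.ActionCategory

theorem curry_map {G S X : Type*} [Group G] [MulAction G S] [Group X]
    (E : ActionCategory G S ⥤ SingleObj X) {a b : ActionCategory G S} (f : a ⟶ b) :
    (curry E f.val).left b.back = E.map f := by
  revert f
  refine ActionCategory.cases (P := fun a b f => (curry E f.val).left b.back = E.map f) ?_ (a := a)
    (b := b)
  exact fun _ _ => rfl

theorem functor_singleObj_ext {C X : Type*} [Category* C] [Monoid X] {E F : C ⥤ SingleObj X}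
    (h : ∀ {a b : C} (f : a ⟶ b), E.map f = F.map f) : E = F :=
  Functor.hext (fun _ => Unit.ext _ _) fun _ _ f => heq_of_eq (h f)

end CategoryTheory.ActionCategory

/-! ### Freeness of the action groupoid of a free product -/

namespace Monoid.Coprod

open CategoryTheory CategoryTheory.ActionCategory MulAction

universe u

/-- A transversal for the orbits of a group `A` acting freely on `S` through a homomorphism
`i : A →* G`: the map `root` picks a point in each orbit, and `shift s` is the element of `A`
that moves the chosen point of the orbit of `s` to `s`. -/
structure OrbitTransversal {A G : Type*} (S : Type*) [Group A] [Group G] [MulAction G S]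
    (i : A →* G) where
  root : S → S
  shift : S → A
  shift_smul_root : ∀ s, i (shift s) • root s = s
  root_smul : ∀ a (s : S), root (i a • s) = root s
  free : ∀ a (s : S), i a • s = s → a = 1

namespace OrbitTransversal

variable {A G S : Type*} [Group A] [Group G] [MulAction G S] {i : A →* G}

theorem nonempty_of_free (free : ∀ a (s : S), i a • s = s → a = 1) :
    Nonempty (OrbitTransversal S i) := by
  let := MulAction.compHom S i
  have key : ∀ s : S, ∃ a : A, i a • (Quotient.mk (orbitRel A S) s).out = s := fun s =>
    (orbitRel A S).symm (Quotient.mk_out (s := orbitRel A S) s)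
  choose t ht using key
  refine ⟨⟨_, t, ht, fun a s => ?_, free⟩⟩
  have : Quotient.mk (orbitRel A S) (i a • s) = Quotient.mk (orbitRel A S) s :=
    Quotient.sound (s := orbitRel A S) ⟨a, rfl⟩
  rw [this]

theorem root_root (T : OrbitTransversal S i) (s : S) : T.root (T.root s) = T.root s := by
  conv_rhs => rw [← T.shift_smul_root s, T.root_smul]

theorem shift_eq_one (T : OrbitTransversal S i) {s : S} (h : T.root s = s) : T.shift s = 1 := by
  refine T.free _ s ?_
  conv_rhs => rw [← T.shift_smul_root s, h]

theorem shift_smul (T : OrbitTransversal S i) (a : A) (s : S) :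
    T.shift (i a • s) = a * T.shift s := by
  rw [← mul_inv_eq_one]
  apply T.free _ (i a • s)
  have h : (i (a * T.shift s))⁻¹ • i a • s = T.root (i a • s) := by
    rw [inv_smul_eq_iff, T.root_smul, map_mul, mul_smul, T.shift_smul_root]
  rw [map_mul, map_inv, mul_smul, h, T.shift_smul_root]

variable {X : Type*} [Group X]

open Classical in
/-- The labelling of the points of `S` that has the prescribed values away from the roots, and the
value `1` at the roots. -/
noncomputable def label (T : OrbitTransversal S i) (f : ∀ s, T.root s ≠ s → X) (s : S) : X :=
  if ne : T.root s ≠ s then f s ne else 1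

theorem label_of_ne (T : OrbitTransversal S i) (f : ∀ s, T.root s ≠ s → X) {s : S}
    (ne : T.root s ≠ s) : T.label f s = f s ne :=
  dif_pos ne

theorem label_of_eq (T : OrbitTransversal S i) (f : ∀ s, T.root s ≠ s → X) {s : S}
    (h : T.root s = s) : T.label f s = 1 :=
  dif_neg (not_not_intro h)

/-- The lift of `i` to the wreath product `(S → X) ⋊ G` obtained by conjugating the trivial lift
with `l : S → X`; as a cocycle `A × S → X` it is the coboundary of `l`. -/
def coboundary (_ : OrbitTransversal S i) (l : S → X) : A →* (S → X) ⋊[mulAutArrow] G :=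
  (MulAut.conj (SemidirectProduct.inl l)).toMonoidHom.comp (SemidirectProduct.inr.comp i)

theorem coboundary_label_left (T : OrbitTransversal S i) (f : ∀ s, T.root s ≠ s → X) (s : S) :
    (T.coboundary (T.label f) (T.shift s)).left s = T.label f s := by
  have h : (i (T.shift s))⁻¹ • s = T.root s := by
    rw [inv_smul_eq_iff, T.shift_smul_root]
  have h1 : (T.coboundary (T.label f) (T.shift s)).left s =
      T.label f s * (T.label f ((i (T.shift s))⁻¹ • s))⁻¹ := by
    simp [coboundary]
    rfl
  rw [h1, h, T.label_of_eq f (T.root_root s), inv_one, mul_one]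

/-- For a free action, a lift of `i` to the wreath product `(S → X) ⋊ G` (equivalently, a cocycle
`A × S → X`) is the coboundary of its values along the arrows from the roots, so these values
determine it. -/
theorem eq_coboundary_label (T : OrbitTransversal S i) (F : A →* (S → X) ⋊[mulAutArrow] G)
    (right : ∀ a, (F a).right = i a) (f : ∀ s, T.root s ≠ s → X)
    (left : ∀ s ne, (F (T.shift s)).left s = f s ne) : F = T.coboundary (T.label f) := by
  have left_shift : ∀ s, (F (T.shift s)).left s = T.label f s := by
    intro s
    by_cases h : T.root s = s
    · rw [T.label_of_eq f h, T.shift_eq_one h, map_one]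
      rfl
    · rw [T.label_of_ne f h, left s h]
  ext1 a
  have key : ∀ s, (F a).left s * T.label f ((i a)⁻¹ • s) = T.label f s := by
    intro s
    have h : T.shift s = a * T.shift ((i a)⁻¹ • s) := by
      rw [← map_inv, T.shift_smul, mul_inv_cancel_left]
    rw [← left_shift s, ← left_shift ((i a)⁻¹ • s), h, map_mul, SemidirectProduct.mul_left, right]
    rfl
  refine eq_mul_inv_of_mul_eq (SemidirectProduct.ext ?_ ?_)
  · rw [SemidirectProduct.mul_left, SemidirectProduct.mul_left, right]
    exact funext fun s => (key s).trans (by simp)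
  · simp [right]

end OrbitTransversal

variable {A B : Type u} [Group A] [Group B] {S : Type u} [MulAction (Monoid.Coprod A B) S]

/-- The edges from `s` to `t` in the graph on `S` in which every point `t` receives an edge from the
root of its `A`-orbit and one from the root of its `B`-orbit, unless `t` is that root itself. -/
inductive TransversalEdge (TA : OrbitTransversal S (inl : A →* Monoid.Coprod A B))
    (TB : OrbitTransversal S (inr : B →* Monoid.Coprod A B)) (s t : S) : Type u
  | left (h : TA.root t = s) (ne : TA.root t ≠ t)
  | right (h : TB.root t = s) (ne : TB.root t ≠ t)

/-- The arrow of the action groupoid of `A ∗ B` represented by an edge. -/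
def TransversalEdge.hom {TA : OrbitTransversal S (inl : A →* Monoid.Coprod A B)}
    {TB : OrbitTransversal S (inr : B →* Monoid.Coprod A B)} {s t : S} :
    TransversalEdge TA TB s t →
      (objEquiv (Monoid.Coprod A B) S s ⟶ objEquiv (Monoid.Coprod A B) S t)
  | .left h _ => ⟨inl (TA.shift t), by
      subst h; exact TA.shift_smul_root t⟩
  | .right h _ => ⟨inr (TB.shift t), by
      subst h; exact TB.shift_smul_root t⟩

/-- If both factors act freely on `S`, then the action groupoid of `A ∗ B` on `S` is free on the
arrows of `TransversalEdge`. A functor to a group `X` is a lift of the identity of `A ∗ B` to the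
wreath product `(S → X) ⋊ (A ∗ B)`, hence a pair of lifts on the factors, and each of these is an
arbitrary labelling of the points that are not roots. -/
@[reducible] noncomputable def isFreeGroupoidActionCategory
    (TA : OrbitTransversal S (inl : A →* Monoid.Coprod A B))
    (TB : OrbitTransversal S (inr : B →* Monoid.Coprod A B)) :
    IsFreeGroupoid (ActionCategory (Monoid.Coprod A B) S) where
  quiverGenerators := ⟨fun a b => TransversalEdge TA TB a.back b.back⟩
  of {a b} e := TransversalEdge.hom e
  unique_lift {X} _ f := by
    -- `f` as a function of points of `S` instead of objects of the groupoid
    let f₀ : ∀ s t : S, TransversalEdge TA TB s t → X := fun s t e =>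
      @f ⟨(), s⟩ ⟨(), t⟩ e
    let lA := TA.label fun t ne => f₀ _ t (.left rfl ne)
    let lB := TB.label fun t ne => f₀ _ t (.right rfl ne)
    let FA := TA.coboundary lA
    let FB := TB.coboundary lB
    let F := lift FA FB
    have sane : ∀ g, (F g).right = g := by
      suffices SemidirectProduct.rightHom.comp F = MonoidHom.id _ from
        DFunLike.congr_fun this
      apply hom_ext
      · ext a; simp [F, FA, OrbitTransversal.coboundary]
      · ext b; simp [F, FB, OrbitTransversal.coboundary]
    refine ⟨uncurry F sane, ?_, ?_⟩
    · rintro ⟨⟨⟩, s : S⟩ ⟨⟨⟩, t : S⟩ e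
      change (F (TransversalEdge.hom (e : TransversalEdge TA TB s t)).val).left t = f e
      change TransversalEdge TA TB s t at e
      cases e with
      | left h ne =>
        cases h
        exact (TA.coboundary_label_left _ t).trans (TA.label_of_ne _ ne)
      | right h ne =>
        cases h
        exact (TB.coboundary_label_left _ t).trans (TB.label_of_ne _ ne)
    · intro E hE
      have : curry E = F := by
        apply hom_ext
        · refine TA.eq_coboundary_label _ (fun _ => rfl) _ fun t ne => ?_
          exact (curry_map E (TransversalEdge.hom (.left rfl ne : TransversalEdge TA TB _ t))).trans
            (hE ⟨(), TA.root t⟩ ⟨(), t⟩ (.left rfl ne))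
        · refine TB.eq_coboundary_label _ (fun _ => rfl) _ fun t ne => ?_
          exact (curry_map E (TransversalEdge.hom (.right rfl ne : TransversalEdge TA TB _ t))).trans
            (hE ⟨(), TB.root t⟩ ⟨(), t⟩ (.right rfl ne))
      refine functor_singleObj_ext fun {a b} f => ?_
      exact (curry_map E f).symm.trans (congrArg (fun F => (F f.val).left b.back) this)

/-- A special case of the Kurosh subgroup theorem: a point stabilizer of a transitive action
of `A ∗ B` in which both factors act freely is a free group. -/
theorem isFreeGroup_stabilizer [IsPretransitive (Monoid.Coprod A B) S]
    (freeA : ∀ a (s : S), (inl a : Monoid.Coprod A B) • s = s → a = 1)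
    (freeB : ∀ b (s : S), (inr b : Monoid.Coprod A B) • s = s → b = 1) (s : S) :
    IsFreeGroup (stabilizer (Monoid.Coprod A B) s) := by
  obtain ⟨TA⟩ := OrbitTransversal.nonempty_of_free freeA
  obtain ⟨TB⟩ := OrbitTransversal.nonempty_of_free freeB
  let := isFreeGroupoidActionCategory TA TB
  have : Nonempty S := ⟨s⟩
  -- the category structure here comes from `ActionCategory`, the one needed from its groupoid
  have conn : IsConnected (ActionCategory (Monoid.Coprod A B) S) := inferInstance
  let x := objEquiv (Monoid.Coprod A B) S s
  have h := @IsFreeGroupoid.endIsFreeOfConnectedFree _ _ conn _ x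
  let e : @MulEquiv (End x) (stabilizer (Monoid.Coprod A B) s) (End.group x).toMul _ :=
    @MulEquiv.mk _ _ (_) _ ⟨fun g => ⟨g.1, g.2⟩, fun g => ⟨g.1, g.2⟩, fun _ => rfl, fun _ => rfl⟩
      fun _ _ => rfl
  exact @IsFreeGroup.ofMulEquiv _ (_) h _ _ e

end Monoid.Coprod

/-! ### Free point stabilizers of actions of a free product -/

theorem IsFreeGroup.eq_one_of_isOfFinOrder {G : Type*} [Group G] [IsFreeGroup G] {g : G}
    (hg : IsOfFinOrder g) : g = 1 := by
  rw [← map_eq_one_iff (IsFreeGroup.toFreeGroup G) (MulEquiv.injective _)]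
  exact (isOfFinOrder_iff_eq_one _).mp
    ((IsFreeGroup.toFreeGroup G).toMonoidHom.isOfFinOrder hg)

namespace MulAction

theorem eq_one_of_isFreeGroup_stabilizer {G S : Type*} [Group G] [MulAction G S]
    [IsPretransitive G S] {x : S} (h : IsFreeGroup (stabilizer G x)) {g : G}
    (hg : IsOfFinOrder g) {s : S} (hs : g • s = s) : g = 1 := by
  obtain ⟨k, rfl⟩ := exists_smul_eq G x s
  have := IsFreeGroup.ofMulEquiv (stabilizerEquivStabilizer (g := k) (rfl : k • x = k • x))
  have h1 : (⟨g, hs⟩ : stabilizer G (k • x)) = 1 :=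
    IsFreeGroup.eq_one_of_isOfFinOrder (Submonoid.isOfFinOrder_coe.mp hg)
  exact congrArg Subtype.val h1

end MulAction

/-- The point stabilizers of a transitive action of a free product of finite groups are free if
and only if both factors act freely: an element of a factor that fixes a point is a torsion element
of a stabilizer. -/
theorem Monoid.Coprod.isFreeGroup_stabilizer_iff.{u} {A B S : Type u} [Group A] [Group B] [Finite A]
    [Finite B] [MulAction (Monoid.Coprod A B) S]
    [MulAction.IsPretransitive (Monoid.Coprod A B) S] (x : S) :
    IsFreeGroup (MulAction.stabilizer (Monoid.Coprod A B) x) ↔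
      (∀ a (s : S), (inl a : Monoid.Coprod A B) • s = s → a = 1) ∧
        ∀ b (s : S), (inr b : Monoid.Coprod A B) • s = s → b = 1 := by
  refine ⟨fun h => ⟨fun a s hs => ?_, fun b s hs => ?_⟩, fun h => isFreeGroup_stabilizer h.1 h.2 x⟩
  · exact (map_eq_one_iff _ inl_injective).mp (MulAction.eq_one_of_isFreeGroup_stabilizer h
      ((inl : A →* Monoid.Coprod A B).isOfFinOrder (isOfFinOrder_of_finite a)) hs)
  · exact (map_eq_one_iff _ inr_injective).mp (MulAction.eq_one_of_isFreeGroup_stabilizer h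
      ((inr : B →* Monoid.Coprod A B).isOfFinOrder (isOfFinOrder_of_finite b)) hs)

/-! ### Transitive permutation representations and subgroups up to conjugacy -/

namespace MonoidHom

open MulAction

variable {G D D' : Type*} [Group G]

/-- The stabilizer of the point `x` under the permutation representation `ρ`. -/
def pointStabilizer (ρ : G →* Equiv.Perm D) (x : D) : Subgroup G :=
  (stabilizer (Equiv.Perm D) x).comap ρ

theorem mem_pointStabilizer {ρ : G →* Equiv.Perm D} {x : D} {g : G} :
    g ∈ ρ.pointStabilizer x ↔ ρ g x = x :=
  Iff.rfl

/-- The permutation representation `ρ` is transitive. -/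
def IsTransitive (ρ : G →* Equiv.Perm D) : Prop :=
  ∀ x y, ∃ g, ρ g x = y

theorem index_pointStabilizer {ρ : G →* Equiv.Perm D} (hρ : ρ.IsTransitive) (x : D) :
    (ρ.pointStabilizer x).index = Nat.card D := by
  let := MulAction.compHom D ρ
  have : IsPretransitive G D := ⟨hρ⟩
  exact index_stabilizer_of_transitive G x

theorem pointStabilizer_apply (ρ : G →* Equiv.Perm D) (g : G) (x : D) :
    ρ.pointStabilizer (ρ g x) = (ρ.pointStabilizer x).map (MulAut.conj g).toMonoidHom := by
  let := MulAction.compHom D ρ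
  exact stabilizer_smul_eq_stabilizer_map_conj g x

/-- Two transitive permutation representations with a common point stabilizer are equivalent. -/
theorem exists_equiv_of_pointStabilizer_eq {ρ : G →* Equiv.Perm D} {ρ' : G →* Equiv.Perm D'}
    (hρ : ρ.IsTransitive) (hρ' : ρ'.IsTransitive) {x : D} {x' : D'}
    (h : ρ.pointStabilizer x = ρ'.pointStabilizer x') :
    ∃ ψ : D ≃ D', ∀ g d, ψ (ρ g d) = ρ' g (ψ d) := by
  choose t ht using hρ x
  have apply_eq_iff : ∀ g k, ρ g x = ρ k x ↔ ρ' g x' = ρ' k x' := by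
    intro g k
    have := SetLike.ext_iff.mp h (k⁻¹ * g)
    rwa [mem_pointStabilizer, mem_pointStabilizer, map_mul, map_mul, map_inv, map_inv,
      Equiv.Perm.mul_apply, Equiv.Perm.mul_apply, Equiv.Perm.inv_eq_iff_eq,
      Equiv.Perm.inv_eq_iff_eq] at this
  have key : ∀ g, ρ' (t (ρ g x)) x' = ρ' g x' := fun g => (apply_eq_iff _ _).mp (ht _)
  have bij : Function.Bijective fun d => ρ' (t d) x' := by
    refine ⟨fun d e hde => ?_, fun d' => ?_⟩
    · rw [← ht d, ← ht e]
      exact (apply_eq_iff _ _).mpr hde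
    · obtain ⟨g, rfl⟩ := hρ' x' d'
      exact ⟨ρ g x, key g⟩
  refine ⟨Equiv.ofBijective _ bij, fun g d => ?_⟩
  have : ρ g d = ρ (g * t d) x := by rw [map_mul, Equiv.Perm.mul_apply, ht]
  rw [Equiv.ofBijective_apply, Equiv.ofBijective_apply, this, key, map_mul, Equiv.Perm.mul_apply]

/-- Transitive permutation representations are equivalent if and only if their point stabilizers
are conjugate. -/
theorem conjugate_pointStabilizer_iff {ρ ρ' : G →* Equiv.Perm D} (hρ : ρ.IsTransitive)
    (hρ' : ρ'.IsTransitive) (x x' : D) :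
    FreeSubgroups.Conjugate (ρ.pointStabilizer x) (ρ'.pointStabilizer x') ↔
      ∃ ψ : Equiv.Perm D, ∀ g, ψ * ρ g * ψ⁻¹ = ρ' g := by
  constructor
  · rintro ⟨k, hk⟩
    rw [← pointStabilizer_apply] at hk
    obtain ⟨ψ, hψ⟩ := exists_equiv_of_pointStabilizer_eq hρ hρ' hk
    exact ⟨ψ, fun g => Equiv.ext fun d => by simp [hψ]⟩
  · rintro ⟨ψ, hψ⟩
    obtain ⟨k, hk⟩ := hρ x (ψ⁻¹ x')
    refine ⟨k, ?_⟩
    rw [← pointStabilizer_apply, hk]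
    ext g
    rw [mem_pointStabilizer, mem_pointStabilizer, ← hψ]
    exact Equiv.Perm.eq_inv_iff_eq

/-- Every subgroup of finite index `n` is a point stabilizer of a transitive permutation
representation on `n` points, namely the one on the cosets. -/
theorem exists_pointStabilizer_eq (Γ : Subgroup G) [Γ.FiniteIndex] :
    ∃ (ρ : G →* Equiv.Perm (Fin Γ.index)) (x : Fin Γ.index),
      ρ.IsTransitive ∧ ρ.pointStabilizer x = Γ := by
  let e : G ⧸ Γ ≃ Fin Γ.index := Finite.equivFin (G ⧸ Γ)
  refine ⟨e.permCongrHom.toMonoidHom.comp (toPermHom G (G ⧸ Γ)), e (1 : G), fun x y => ?_, ?_⟩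
  · obtain ⟨g, hg⟩ := exists_smul_eq G (e.symm x) (e.symm y)
    exact ⟨g, by simp [Equiv.permCongrHom, hg]⟩
  · ext g
    rw [mem_pointStabilizer]
    conv_rhs => rw [← stabilizer_quotient Γ, mem_stabilizer_iff]
    simp [Equiv.permCongrHom]

end MonoidHom

/-! ### Hypermaps as actions of `ℤ_p * ℤ_q` -/

namespace Hypermap

open FreeSubgroups Multiplicative Monoid.Coprod

variable {D : Type*}

theorem ofAdd_one_pow (p : ℕ) [NeZero p] (a : Multiplicative (ZMod p)) :
    ofAdd (1 : ZMod p) ^ a.toAdd.val = a := by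
  rw [← ofAdd_nsmul]
  simp

/-- A permutation of order dividing `p`, given as a homomorphism from the cyclic group of
order `p`, has all cycles of length `p` if and only if that group acts freely through it. -/
theorem allCyclesHaveLength_iff {p : ℕ} [NeZero p] (f : Multiplicative (ZMod p) →* Equiv.Perm D) :
    AllCyclesHaveLength (f (ofAdd 1)) p ↔ ∀ a s, f a s = s → a = 1 := by
  have periodic_iff : ∀ k s, Function.IsPeriodicPt (f (ofAdd 1)) k s ↔ f (ofAdd 1 ^ k) s = s := by
    intro k s
    rw [Function.IsPeriodicPt, Equiv.Perm.iterate_eq_pow, map_pow]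
    rfl
  have pow_eq_one : ∀ k, ofAdd (1 : ZMod p) ^ k = 1 ↔ p ∣ k := by
    intro k
    rw [← ofAdd_nsmul, nsmul_one, ofAdd_eq_one, ZMod.natCast_eq_zero_iff]
  constructor
  · intro h a s has
    rw [← ofAdd_one_pow p a] at has ⊢
    rw [pow_eq_one]
    exact (h s).symm.dvd.trans ((periodic_iff _ _).mpr has).minimalPeriod_dvd
  · intro h s
    refine Nat.dvd_antisymm ?_ ?_
    · refine ((periodic_iff _ _).mpr ?_).minimalPeriod_dvd
      rw [(pow_eq_one p).mpr dvd_rfl, map_one]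
      rfl
    · rw [← pow_eq_one]
      exact h _ s ((periodic_iff _ _).mp (Function.isPeriodicPt_minimalPeriod _ _))

theorem AllCyclesHaveLength.pow_eq_one {f : Equiv.Perm D} {p : ℕ}
    (h : AllCyclesHaveLength f p) : f ^ p = 1 := by
  ext x
  rw [← Equiv.Perm.iterate_eq_pow, ← h x]
  exact Function.isPeriodicPt_minimalPeriod f x

/-- The homomorphism from the cyclic group of order `p` that sends the generator to a permutation
with all cycles of length `p`. -/
def AllCyclesHaveLength.hom {f : Equiv.Perm D} {p : ℕ} (h : AllCyclesHaveLength f p) :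
    Multiplicative (ZMod p) →* Equiv.Perm D :=
  AddMonoidHom.toMultiplicativeLeft (ZMod.lift p ⟨zmultiplesHom _ (Additive.ofMul f), by
    rw [zmultiplesHom_apply, natCast_zsmul, ← ofMul_pow, h.pow_eq_one, ofMul_one]⟩)

theorem AllCyclesHaveLength.hom_ofAdd_one {f : Equiv.Perm D} {p : ℕ}
    (h : AllCyclesHaveLength f p) : h.hom (ofAdd 1) = f := by
  have := ZMod.lift_coe p ⟨zmultiplesHom _ (Additive.ofMul f), by
    rw [zmultiplesHom_apply, natCast_zsmul, ← ofMul_pow, h.pow_eq_one, ofMul_one]⟩ 1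
  rw [Int.cast_one] at this
  exact congrArg Additive.toMul (this.trans (one_zsmul _))

theorem zmod_hom_ext {p : ℕ} [NeZero p] {M : Type*} [Monoid M] {f g : Multiplicative (ZMod p) →* M}
    (h : f (ofAdd 1) = g (ofAdd 1)) : f = g := by
  refine MonoidHom.ext fun a => ?_
  rw [← ofAdd_one_pow p a, map_pow, map_pow, h]

variable {p q : ℕ}

theorem hom_ext_generators [NeZero p] [NeZero q] {M : Type*} [Monoid M]
    {f g : CyclicFreeProduct p q →* M} (hl : f (inl (ofAdd 1)) = g (inl (ofAdd 1)))
    (hr : f (inr (ofAdd 1)) = g (inr (ofAdd 1))) : f = g :=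
  hom_ext (zmod_hom_ext hl) (zmod_hom_ext hr)

/-- The action of `ℤ_p * ℤ_q` on the darts of a `(p,q)`-hypermap: the generators act as `α` and
`φ`. -/
def IsPQ.monodromy {H : Hypermap D} (h : H.IsPQ p q) : CyclicFreeProduct p q →* Equiv.Perm D :=
  lift h.1.hom h.2.hom

theorem IsPQ.monodromy_inl {H : Hypermap D} (h : H.IsPQ p q) :
    h.monodromy (inl (ofAdd 1)) = H.α :=
  h.1.hom_ofAdd_one

theorem IsPQ.monodromy_inr {H : Hypermap D} (h : H.IsPQ p q) :
    h.monodromy (inr (ofAdd 1)) = H.φ :=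
  h.2.hom_ofAdd_one

theorem σ_eq (H : Hypermap D) : H.σ = H.φ⁻¹ * H.α⁻¹ := by simp [φ]

theorem IsPQ.isTransitive_monodromy {H : Hypermap D} (h : H.IsPQ p q) :
    h.monodromy.IsTransitive := by
  have le : Subgroup.closure {H.α, H.σ} ≤ h.monodromy.range := by
    have hα : H.α ∈ h.monodromy.range := ⟨_, h.monodromy_inl⟩
    have hφ : H.φ ∈ h.monodromy.range := ⟨_, h.monodromy_inr⟩
    rw [Subgroup.closure_le, Set.pair_subset_iff]
    exact ⟨hα, H.σ_eq ▸ mul_mem (inv_mem hφ) (inv_mem hα)⟩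
  intro x y
  obtain ⟨⟨c, hc⟩, rfl⟩ := H.transitive.exists_smul_eq x y
  obtain ⟨g, rfl⟩ := le hc
  exact ⟨g, rfl⟩

/-- The permutations `α` and `σ` determine `φ` and are determined by `α` and `φ`, so isomorphism
of hypermaps is equivalence of the actions on the darts. -/
theorem isPQ_isomorphic_iff [NeZero p] [NeZero q] {H₁ H₂ : Hypermap D} (h₁ : H₁.IsPQ p q)
    (h₂ : H₂.IsPQ p q) :
    Isomorphic H₁ H₂ ↔ ∃ ψ : Equiv.Perm D, ∀ g, ψ * h₁.monodromy g * ψ⁻¹ = h₂.monodromy g := by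
  refine exists_congr fun ψ => ⟨fun ⟨hα, hσ⟩ => ?_, fun h => ?_⟩
  · suffices (MulAut.conj ψ).toMonoidHom.comp h₁.monodromy = h₂.monodromy from
      DFunLike.congr_fun this
    apply hom_ext_generators
    · simp [IsPQ.monodromy_inl, hα]
    · simp only [MonoidHom.comp_apply, IsPQ.monodromy_inr, φ, ← hα, ← hσ]
      simp
      group
  · have hα := h (inl (ofAdd 1))
    have hφ := h (inr (ofAdd 1))
    rw [IsPQ.monodromy_inl, IsPQ.monodromy_inl] at hα
    rw [IsPQ.monodromy_inr, IsPQ.monodromy_inr] at hφ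
    refine ⟨hα, ?_⟩
    rw [σ_eq, σ_eq, ← hα, ← hφ]
    group

theorem isFreeGroup_pointStabilizer_iff [NeZero p] [NeZero q] {D : Type}
    {ρ : CyclicFreeProduct p q →* Equiv.Perm D} (hρ : ρ.IsTransitive) (x : D) :
    IsFreeGroup (ρ.pointStabilizer x) ↔ AllCyclesHaveLength (ρ (inl (ofAdd 1))) p ∧
      AllCyclesHaveLength (ρ (inr (ofAdd 1))) q := by
  let := MulAction.compHom D ρ
  have : MulAction.IsPretransitive (CyclicFreeProduct p q) D := ⟨hρ⟩
  exact (Monoid.Coprod.isFreeGroup_stabilizer_iff x).trans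
    (and_congr (allCyclesHaveLength_iff (ρ.comp inl)) (allCyclesHaveLength_iff (ρ.comp inr))).symm

/-- A transitive action of `ℤ_p * ℤ_q` in which the generators have all cycles of the lengths `p`
and `q` is the action on the darts of a `(p,q)`-hypermap. -/
theorem exists_monodromy_eq [NeZero p] [NeZero q] [Nonempty D]
    {ρ : CyclicFreeProduct p q →* Equiv.Perm D} (hρ : ρ.IsTransitive)
    (hα : AllCyclesHaveLength (ρ (inl (ofAdd 1))) p)
    (hφ : AllCyclesHaveLength (ρ (inr (ofAdd 1))) q) :
    ∃ (H : Hypermap D) (h : H.IsPQ p q), h.monodromy = ρ := by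
  set α := ρ (inl (ofAdd 1))
  set β := ρ (inr (ofAdd 1))
  -- the permutation `σ` for which `φ = α⁻¹ σ⁻¹` becomes `β`
  have hβ : α⁻¹ * (β⁻¹ * α⁻¹)⁻¹ = β := by group
  have mem : ∀ g, ρ g ∈ Subgroup.closure {α, β⁻¹ * α⁻¹} := by
    have hα : α ∈ Subgroup.closure {α, β⁻¹ * α⁻¹} := Subgroup.subset_closure (by simp)
    have hσ : β⁻¹ * α⁻¹ ∈ Subgroup.closure {α, β⁻¹ * α⁻¹} := Subgroup.subset_closure (by simp)
    have hβ' : β ∈ Subgroup.closure {α, β⁻¹ * α⁻¹} := by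
      have := mul_mem (inv_mem hα) (inv_mem hσ)
      rwa [hβ] at this
    intro g
    induction g using Monoid.Coprod.induction_on with
    | inl a => rw [← ofAdd_one_pow p a, map_pow, map_pow]; exact pow_mem hα _
    | inr b => rw [← ofAdd_one_pow q b, map_pow, map_pow]; exact pow_mem hβ' _
    | mul g k hg hk => rw [map_mul]; exact mul_mem hg hk
  let H : Hypermap D := ⟨α, β⁻¹ * α⁻¹, ‹_›, ⟨fun x y => by
    obtain ⟨g, hg⟩ := hρ x y
    exact ⟨⟨ρ g, mem g⟩, hg⟩⟩⟩
  have h : H.IsPQ p q := ⟨hα, (congrArg (AllCyclesHaveLength · q) hβ).mpr hφ⟩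
  exact ⟨H, h, hom_ext_generators h.monodromy_inl (h.monodromy_inr.trans hβ)⟩

instance finite_hypermap [Finite D] : Finite (Hypermap D) :=
  Finite.of_injective (fun H => (H.α, H.σ)) fun H₁ H₂ h => by
    cases H₁; cases H₂; simp_all

/-- The stabilizer of an arbitrarily chosen dart of a `(p,q)`-hypermap, as a free subgroup
of `ℤ_p * ℤ_q`. -/
noncomputable def dartStabilizer [NeZero p] [NeZero q] {n : ℕ}
    (H : {H : Hypermap (Fin n) // H.IsPQ p q}) : FreeOfIndex (CyclicFreeProduct p q) n :=
  let ρ := H.2.monodromy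
  let x := H.1.nonempty.some
  have hρ : ρ.IsTransitive := H.2.isTransitive_monodromy
  have index_eq : (ρ.pointStabilizer x).index = n := by
    rw [MonoidHom.index_pointStabilizer hρ, Nat.card_fin]
  ⟨ρ.pointStabilizer x, ⟨by rw [index_eq]; exact (Fin.pos x).ne'⟩, index_eq,
    (isFreeGroup_pointStabilizer_iff hρ x).mpr
      ⟨H.2.monodromy_inl.symm ▸ H.2.1, H.2.monodromy_inr.symm ▸ H.2.2⟩⟩

theorem conjugate_dartStabilizer_iff [NeZero p] [NeZero q] {n : ℕ}
    (H₁ H₂ : {H : Hypermap (Fin n) // H.IsPQ p q}) :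
    Conjugate (dartStabilizer H₁).1 (dartStabilizer H₂).1 ↔ Isomorphic H₁.1 H₂.1 :=
  (MonoidHom.conjugate_pointStabilizer_iff H₁.2.isTransitive_monodromy
    H₂.2.isTransitive_monodromy _ _).trans (isPQ_isomorphic_iff H₁.2 H₂.2).symm

/-- A free subgroup of index `n` is conjugate to the stabilizer of the dart chosen in the hypermap
on its cosets, since all dart stabilizers of a hypermap are conjugate. -/
theorem exists_conjugate_dartStabilizer [NeZero p] [NeZero q] {n : ℕ}
    (Γ : FreeOfIndex (CyclicFreeProduct p q) n) :
    ∃ H : {H : Hypermap (Fin n) // H.IsPQ p q}, Conjugate (dartStabilizer H).1 Γ.1 := by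
  obtain ⟨Γ, hfin, rfl, hfree⟩ := Γ
  obtain ⟨ρ, x, hρ, hx⟩ := MonoidHom.exists_pointStabilizer_eq Γ
  have hfree' : IsFreeGroup (ρ.pointStabilizer x) := hx.symm ▸ hfree
  rw [isFreeGroup_pointStabilizer_iff hρ] at hfree'
  have : Nonempty (Fin Γ.index) := ⟨x⟩
  obtain ⟨H, h, rfl⟩ := exists_monodromy_eq hρ hfree'.1 hfree'.2
  obtain ⟨k, hk⟩ := hρ H.nonempty.some x
  refine ⟨⟨H, h⟩, k, ?_⟩
  change (h.monodromy.pointStabilizer H.nonempty.some).map _ = Γ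
  rw [← MonoidHom.pointStabilizer_apply, hk, hx]

/-- Taking dart stabilizers is a bijection from the isomorphism classes of `(p,q)`-hypermaps on `n`
darts to the conjugacy classes of free subgroups of index `n`. -/
theorem nonempty_pqClasses_equiv [NeZero p] [NeZero q] (n : ℕ) :
    Nonempty (PQClasses p q n ≃ ConjClassesOfIndex (CyclicFreeProduct p q) n) := by
  refine ⟨Equiv.ofBijective (Quotient.map dartStabilizer fun H₁ H₂ =>
    (conjugate_dartStabilizer_iff H₁ H₂).mpr) ⟨?_, ?_⟩⟩
  · rintro ⟨H₁⟩ ⟨H₂⟩ h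
    exact Quotient.sound ((conjugate_dartStabilizer_iff H₁ H₂).mp (Quotient.exact h))
  · rintro ⟨Γ⟩
    obtain ⟨H, hH⟩ := exists_conjugate_dartStabilizer Γ
    exact ⟨Quotient.mk _ H, Quotient.sound hH⟩

end Hypermap

theorem mainTheorem8 (p q : ℕ) (hpq : 6 ≤ p * q) :
    (∀ n : ℕ, Finite
      (FreeSubgroups.ConjClassesOfIndex (FreeSubgroups.CyclicFreeProduct p q) n)) ∧
    FreeSubgroups.conjGrowthSeries (FreeSubgroups.CyclicFreeProduct p q) =
      Hypermap.isoGrowthSeries p q := by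
  have : NeZero p := ⟨by rintro rfl; omega⟩
  have : NeZero q := ⟨by rintro rfl; omega⟩
  refine ⟨fun n => ?_, PowerSeries.ext fun n => ?_⟩
  · obtain ⟨e⟩ := Hypermap.nonempty_pqClasses_equiv (p := p) (q := q) n
    exact Finite.of_equiv _ e
  · obtain ⟨e⟩ := Hypermap.nonempty_pqClasses_equiv (p := p) (q := q) n
    simp only [FreeSubgroups.conjGrowthSeries, Hypermap.isoGrowthSeries, PowerSeries.coeff_mk]
    rw [Nat.card_congr e]
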